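/- Let $d\in\mathbb N$, $I_\pm=\{\pm1,\dots,\pm d\}$, and let $r:I_\pm\to\mathbb Z^d$ be any jump function. For a permutation $\pi$ of $I_\pm$ and phases $\Theta=(\theta_\sigma)_{\sigma\in I_\pm}$ let $C(\pi,\Theta)\in U(2d)$ be the phased permutation matrix with entries $C(\pi,\Theta)_{\sigma\tau}=e^{i\theta_\sigma}\delta_{\sigma,\pi(\tau)}$, and put $C(\pi)=C(\pi,0)$. Let $C_k=C(\pi_k,\Theta_k)$, $k\ge1$, be i.i.d. random matrices of this form on a probability space, let $\mu$ be the law of the permutation part $\pi_k$ (it does not depend on $k$), and let $$P(\sigma',\sigma)=\sum_{\pi}\mu(\pi)\,\delta_{\sigma,\pi(\sigma')},\qquad \sigma',\sigma\in I_\pm .$$ Let $\varphi_0=\sum_{\tau\in I_\pm}a_\tau|\tau\rangle\in\mathbb C^{2d}$ be a unit vector, let $\tau_0$ be an $I_\pm$-valued random variable with law $p_0(\tau)=|a_\tau|^2$, independent of the sequence $(C_k)_{k\ge1}$, and let $\tau_j=(\pi_j\pi_{j-1}\cdots\pi_1)(\tau_0)$, $j\ge0$, be the coin path. Assume that $P$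 is irreducible. Then: 1. $P$ is doubly stochastic, $P=\mathbb E(C(\pi_k)^T)$ for every $k\ge1$, and $(\tau_j)_{j\ge0}$ is a Markov chain with finite state space $I_\pm$, initial distribution $p_0$ and transition matrix $P$. 2. With $\bar r=\frac1{2d}\sum_{\tau\in I_\pm}r(\tau)$, $$\lim_{n\to\infty}\frac1n\sum_{j=1}^n r(\tau_j)=\bar r\quad\text{almost surely.}$$ 3. Let $u_0\in\mathbb R^{2d}$ have all components $\frac1{2d}$, let $Q=\mathbb I-2d\,|u_0\rangle\langle u_0|$ and $P_Q=QPQ$. Then $P_Q-\mathbb I$ is invertible. Let $S(1)=(P_Q-\mathbb I)^{-1}Q$ be the reduced resolvent of $P$ at $1$; it satisfies $(P-\mathbb I)S(1)=S(1)(P-\mathbb I)=Q$. With $r_i=(r(\tau)_i)_{\tau\in I_\pm}\in\mathbb R^{2d}$ for $1\le i\le d$, the matrix $$\Sigma_{ij}=-\frac1{2d}\langle r_i|r_j\rangle+\bar r_i\bar r_j-\frac1{2d}\bigl(\langle r_i|S(1)r_j\rangle+\langle r_j|S(1)r_i\rangle\bigr)$$ is positive semidefinite and, as $n\to\infty$,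 in distribution, $$\frac1{\sqrt n}\sum_{j=1}^n\bigl(r(\tau_j)-\bar r\bigr)\longrightarrow\mathcal N(0,\Sigma),$$ where $\mathcal N(0,\Sigma)$ is the centered, possibly degenerate, normal law on $\mathbb R^d$ with covariance matrix $\Sigma$. -/

import Mathlib

open MeasureTheory ProbabilityTheory Filter Topology Matrix

noncomputable section

namespace QuantumWalk

/-- The set `I_± = {±1, …, ±d}` of coin states. -/
abbrev CoinIndex (d : ℕ) : Type :=
  {z : ℤ // z ∈ (Finset.Icc (-(d : ℤ)) (d : ℤ)).erase 0}

/-- The Borel (product) σ-algebra on the coin matrices. -/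
instance coinMeasurableSpace (d : ℕ) :
    MeasurableSpace (Matrix (CoinIndex d) (CoinIndex d) ℂ) :=
  inferInstanceAs (MeasurableSpace (CoinIndex d → CoinIndex d → ℂ))

/-- The phased permutation matrix `C(π, Θ) = ∑_τ e^{i θ_{π(τ)}} |π(τ)⟩⟨τ|`, that is,
`C(π, Θ)_{στ} = e^{i θ_σ} δ_{σ, π(τ)}`. The phases are given as real numbers (angles). -/
def phasedPerm {d : ℕ} (π : Equiv.Perm (CoinIndex d)) (Θ : CoinIndex d → ℝ) :
    Matrix (CoinIndex d) (CoinIndex d) ℂ :=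
  Matrix.of fun σ τ => if σ = π τ then Complex.exp (Complex.I * (Θ σ : ℂ)) else 0

variable {X : Type*} [MeasurableSpace X]

/-- The marginal law `μ(π) = ν(C ∈ {C(π, Θ) : Θ})` on permutations of a random coin matrix `C`. -/
def permLaw {d : ℕ} (ν : Measure X) (C : X → Matrix (CoinIndex d) (CoinIndex d) ℂ)
    (π : Equiv.Perm (CoinIndex d)) : ℝ :=
  ν.real {ω | ∃ Θ : CoinIndex d → ℝ, C ω = phasedPerm π Θ}

/-- The transition matrix `P(σ', σ) = ∑_π μ(π) δ_{σ, π(σ')}`. -/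
def transitionMatrix {d : ℕ} (ν : Measure X) (C : X → Matrix (CoinIndex d) (CoinIndex d) ℂ) :
    Matrix (CoinIndex d) (CoinIndex d) ℝ :=
  Matrix.of fun σ' σ =>
    ∑ π : Equiv.Perm (CoinIndex d), permLaw ν C π * (if σ = π σ' then 1 else 0)

/-- The coin path `τ_j = (π_j π_{j-1} ⋯ π_1)(τ_0)`; the permutation `π_j`, `j ≥ 1`, of the text is
`π (j - 1)` here. -/
def coinPath {d : ℕ} (τ₀ : X → CoinIndex d) (π : ℕ → X → Equiv.Perm (CoinIndex d)) :
    ℕ → X → CoinIndex d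
  | 0 => τ₀
  | j + 1 => fun ω => π j ω (coinPath τ₀ π j ω)

/-- `τ` is a (time-homogeneous) Markov chain on `S` with initial distribution `p₀` and transition
matrix `P`. -/
structure IsMarkovChain {S : Type*} [MeasurableSpace S] (ν : Measure X) (τ : ℕ → X → S)
    (p₀ : S → ℝ) (P : Matrix S S ℝ) : Prop where
  measurable : ∀ n, Measurable (τ n)
  initial : ∀ s, ν.real {ω | τ 0 ω = s} = p₀ s
  transition : ∀ (n : ℕ) (s : ℕ → S) (t : S), ν {ω | ∀ k ≤ n, τ k ω = s k} ≠ 0 →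
    (ν[|{ω | ∀ k ≤ n, τ k ω = s k}]).real {ω | τ (n + 1) ω = t} = P (s n) t

/-- The jump function, with values regarded as vectors of the Euclidean space `ℝ^d`. -/
def jumpVec {d : ℕ} (r : CoinIndex d → Fin d → ℤ) (τ : CoinIndex d) : EuclideanSpace ℝ (Fin d) :=
  WithLp.toLp 2 fun i => (r τ i : ℝ)

/-- The drift `r̄ = (1 / 2d) ∑_τ r(τ)`. -/
def drift {d : ℕ} (r : CoinIndex d → Fin d → ℤ) : EuclideanSpace ℝ (Fin d) :=
  (1 / (2 * d : ℝ)) • ∑ τ, jumpVec r τ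

/-- The projection `Q = 1 - 2d |u₀⟩⟨u₀|`, where `u₀` is the vector with all components `1 / 2d`. -/
def projQ (d : ℕ) : Matrix (CoinIndex d) (CoinIndex d) ℝ :=
  1 - Matrix.of fun _ _ => 1 / (2 * d : ℝ)

/-- The reduced resolvent `S(1)` of `P` at `1`: the inverse of `P_Q - 1`, `P_Q = Q P Q`, on the
range of `Q`, and zero on the range of `1 - Q`. (On the range of `1 - Q` the matrix `Q P Q - 1`
is `-1`, so it is invertible iff its restriction to the range of `Q` is.) -/
def reducedResolvent {d : ℕ} (P : Matrix (CoinIndex d) (CoinIndex d) ℝ) :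
    Matrix (CoinIndex d) (CoinIndex d) ℝ :=
  (projQ d * P * projQ d - 1)⁻¹ * projQ d

/-- The vector `r_i ∈ ℝ^{2d}` of the `i`-th components of the jumps. -/
def jumpComp {d : ℕ} (r : CoinIndex d → Fin d → ℤ) (i : Fin d) : CoinIndex d → ℝ :=
  fun τ => (r τ i : ℝ)

/-- The covariance matrix
`Σ_ij = -(1/2d) ⟨r_i | r_j⟩ + r̄_i r̄_j - (1/2d) (⟨r_i | S(1) r_j⟩ + ⟨r_j | S(1) r_i⟩)`. -/
def covMatrix {d : ℕ} (r : CoinIndex d → Fin d → ℤ)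
    (P : Matrix (CoinIndex d) (CoinIndex d) ℝ) : Matrix (Fin d) (Fin d) ℝ :=
  Matrix.of fun i j =>
    -(1 / (2 * d : ℝ)) * (jumpComp r i ⬝ᵥ jumpComp r j) + drift r i * drift r j
      - (1 / (2 * d : ℝ)) * (jumpComp r i ⬝ᵥ (reducedResolvent P *ᵥ jumpComp r j)
          + jumpComp r j ⬝ᵥ (reducedResolvent P *ᵥ jumpComp r i))

end QuantumWalk

end

/-! The coin path applies i.i.d. random bijections to an independent starting point, so it is a
Markov chain. Row sums of `P` are total probabilities; column sums are as well, because each map is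
invertible. Thus the uniform law is stationary, and the maximum principle together with
irreducibility makes harmonic functions constant. Hence `P - 1` is invertible on centred functions,
and the reduced resolvent solves every Poisson equation with centred right-hand side. Both limit
theorems rest on this solvability; no mixing, aperiodicity or stationary start enters.

For centred `f`, a corrector `g` with `P (f + g) = g` turns the partial sum plus `g (τ n)` into a
martingale. Its second moment grows linearly, which gives convergence along squares by summability;
monotone interpolation fills the gaps (`ae_tendsto_sum_div`).

For the central limit theorem, the operator `u ↦ P (exp (i s f) u)` has, up to `O(s ^ 3)`, the
eigenvalue `exp (-v s ^ 2 / 2)` with eigenfunction `1 + i s g₁ + s ^ 2 g₂`. Iterating `n` times at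
`s = 1 / √n` costs only `O(1 / √n)`, so characteristic functions converge (`tendsto_integral_exp`).
Solvability for `g₂` fixes `v`, and `exists_correctors` identifies it with the quadratic form of the
covariance matrix. Its sign follows from the `ℓ²` contractivity of `P`. Testing against an arbitrary
vector `t` reduces the vector case to the scalar one. -/

namespace QuantumWalk

/-! ### Irreducible doubly stochastic matrices -/

section Harmonic

variable {S : Type*} [Fintype S] [DecidableEq S]

/-- Harmonic functions of an irreducible doubly stochastic matrix are constant. -/
theorem eq_of_mulVec_eq_self {P : Matrix S S ℝ} (hP : P ∈ doublyStochastic ℝ S)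
    (hirr : P.IsIrreducible) {v : S → ℝ} (hv : P *ᵥ v = v) (x y : S) : v x = v y := by
  have hpow (k : ℕ) : (P ^ k) *ᵥ v = v := by
    induction k with
    | zero => simp
    | succ k ih => rw [pow_succ, ← mulVec_mulVec, hv, ih]
  have : Nonempty S := ⟨x⟩
  obtain ⟨m, hm⟩ := Finite.exists_max v
  suffices h : ∀ y, v m = v y from (h x).symm.trans (h y)
  intro y
  -- Maximum principle: the `P ^ k`-average at `m` of the nonnegative function `v m - v t` vanishes,
  -- so it is zero wherever the weight is positive; irreducibility supplies a `k` charging `y`.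
  obtain ⟨k, -, hk⟩ := (isIrreducible_iff_exists_pow_pos hirr.nonneg).1 hirr m y
  have hPk : P ^ k ∈ doublyStochastic ℝ S := pow_mem hP k
  have hsum : ∑ t, (P ^ k) m t * (v m - v t) = 0 := by
    have h1 := congrFun (hpow k) m
    simp only [mulVec, dotProduct] at h1
    simp only [mul_sub, Finset.sum_sub_distrib, ← Finset.sum_mul, h1,
      sum_row_of_mem_doublyStochastic hPk, one_mul, sub_self]
  have h0 := (Finset.sum_eq_zero_iff_of_nonneg fun t _ =>
    mul_nonneg (nonneg_of_mem_doublyStochastic hPk) (sub_nonneg.2 (hm t))).1 hsum y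
    (Finset.mem_univ y)
  rcases mul_eq_zero.1 h0 with h | h
  · exact absurd h hk.ne'
  · linarith

/-- Jensen's inequality in each row (the variance under `P x ·` is nonnegative), summed over `x`
using unit column sums. -/
theorem dotProduct_mulVec_le {P : Matrix S S ℝ} (hP : P ∈ doublyStochastic ℝ S) (g : S → ℝ) :
    (P *ᵥ g) ⬝ᵥ (P *ᵥ g) ≤ g ⬝ᵥ g := by
  have h1 (x : S) : (P *ᵥ g) x * (P *ᵥ g) x ≤ ∑ t, P x t * (g t * g t) := by
    have h : 0 ≤ ∑ t, P x t * (g t - (P *ᵥ g) x) ^ 2 :=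
      Finset.sum_nonneg fun t _ => mul_nonneg (nonneg_of_mem_doublyStochastic hP) (sq_nonneg _)
    have h2 : ∑ t, P x t * (g t - (P *ᵥ g) x) ^ 2
        = ∑ t, P x t * (g t * g t) - 2 * (P *ᵥ g) x * ∑ t, P x t * g t
          + (P *ᵥ g) x ^ 2 * ∑ t, P x t := by
      rw [Finset.mul_sum, Finset.mul_sum, ← Finset.sum_sub_distrib, ← Finset.sum_add_distrib]
      exact Finset.sum_congr rfl fun t _ => by ring
    have h3 : ∑ t, P x t * g t = (P *ᵥ g) x := rfl
    rw [h2, h3, sum_row_of_mem_doublyStochastic hP] at h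
    nlinarith
  calc (P *ᵥ g) ⬝ᵥ (P *ᵥ g) ≤ ∑ x, ∑ t, P x t * (g t * g t) := Finset.sum_le_sum fun x _ => h1 x
    _ = g ⬝ᵥ g := by
      rw [Finset.sum_comm]
      simp [← Finset.sum_mul, sum_col_of_mem_doublyStochastic hP, dotProduct]

end Harmonic

/-! ### The centring projection and the reduced resolvent -/

section Resolvent

theorem card_coinIndex (d : ℕ) : Fintype.card (CoinIndex d) = 2 * d := by
  rw [Fintype.card_coe, Finset.card_erase_of_mem (by simp), Int.card_Icc]
  omega

variable {d : ℕ} {P : Matrix (CoinIndex d) (CoinIndex d) ℝ}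

theorem projQ_mulVec (v : CoinIndex d → ℝ) (x : CoinIndex d) :
    (projQ d *ᵥ v) x = v x - 1 / (2 * d : ℝ) * ∑ t, v t := by
  rw [projQ, sub_mulVec, one_mulVec, Pi.sub_apply]
  simp only [mulVec, dotProduct, of_apply, Finset.mul_sum]

theorem projQ_transpose (d : ℕ) : (projQ d)ᵀ = projQ d := by
  ext i j
  simp [projQ, one_apply, eq_comm]

theorem dotProduct_projQ_mulVec (v w : CoinIndex d → ℝ) :
    (projQ d *ᵥ v) ⬝ᵥ w = v ⬝ᵥ (projQ d *ᵥ w) := by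
  rw [dotProduct_mulVec, ← mulVec_transpose, projQ_transpose]

theorem sum_projQ_mulVec (hd : d ≠ 0) (v : CoinIndex d → ℝ) : ∑ x, (projQ d *ᵥ v) x = 0 := by
  have : (d : ℝ) ≠ 0 := by exact_mod_cast hd
  simp only [projQ_mulVec, Finset.sum_sub_distrib, Finset.sum_const, Finset.card_univ,
    card_coinIndex, nsmul_eq_mul]
  push_cast
  field_simp
  ring

theorem projQ_mulVec_of_sum_eq_zero {v : CoinIndex d → ℝ} (hv : ∑ x, v x = 0) :
    projQ d *ᵥ v = v := by
  ext x
  rw [projQ_mulVec, hv, mul_zero, sub_zero]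

theorem projQ_mul_self (hd : d ≠ 0) : projQ d * projQ d = projQ d := by
  refine ext_iff_mulVec.2 fun v => ?_
  rw [← mulVec_mulVec, projQ_mulVec_of_sum_eq_zero (sum_projQ_mulVec hd v)]

theorem sum_mulVec_eq (hP : P ∈ doublyStochastic ℝ (CoinIndex d)) (v : CoinIndex d → ℝ) :
    ∑ x, (P *ᵥ v) x = ∑ x, v x := by
  simp only [mulVec, dotProduct]
  rw [Finset.sum_comm]
  simp only [← Finset.sum_mul, sum_col_of_mem_doublyStochastic hP, one_mul]

/-- Column sums say that `P` preserves the mean, row sums that it fixes constants; together they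
give commutation with centring. -/
theorem projQ_mul_comm (hP : P ∈ doublyStochastic ℝ (CoinIndex d)) :
    projQ d * P = P * projQ d := by
  refine ext_iff_mulVec.2 fun v => ?_
  ext x
  rw [← mulVec_mulVec, ← mulVec_mulVec, projQ_mulVec, sum_mulVec_eq hP]
  have h (t : CoinIndex d) := projQ_mulVec v t
  simp only [mulVec, dotProduct] at h ⊢
  simp only [h, mul_sub, Finset.sum_sub_distrib, ← Finset.sum_mul,
    sum_row_of_mem_doublyStochastic hP, one_mul]

/-- A kernel vector lies in the range of `Q`, so it is centred; there `Q` drops out and the vector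
is harmonic, hence constant, hence zero. -/
theorem isUnit_projQ_mul_mul_projQ_sub_one (hd : d ≠ 0)
    (hP : P ∈ doublyStochastic ℝ (CoinIndex d)) (hirr : P.IsIrreducible) :
    IsUnit (projQ d * P * projQ d - 1) := by
  rw [← mulVec_injective_iff_isUnit]
  refine (injective_iff_map_eq_zero (mulVecLin (projQ d * P * projQ d - 1))).2 fun v hv => ?_
  have h1 : projQ d *ᵥ (P *ᵥ (projQ d *ᵥ v)) = v := by
    simpa [sub_mulVec, sub_eq_zero, mulVec_mulVec, Matrix.mul_assoc] using hv
  have hsum : ∑ x, v x = 0 := by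
    rw [← h1, sum_projQ_mulVec hd]
  rw [projQ_mulVec_of_sum_eq_zero hsum, projQ_mulVec_of_sum_eq_zero
    ((sum_mulVec_eq hP v).trans hsum)] at h1
  ext x
  have hconst := eq_of_mulVec_eq_self hP hirr h1
  have h2 : ∑ y, v y = (2 * d : ℝ) * v x := by
    rw [Finset.sum_congr rfl fun y _ => hconst y x]
    rw [Finset.sum_const, Finset.card_univ, card_coinIndex, nsmul_eq_mul]
    push_cast
    rfl
  have : (d : ℝ) ≠ 0 := by exact_mod_cast hd
  rw [hsum, eq_comm] at h2
  simpa [this] using h2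

theorem sub_one_mul_reducedResolvent (hd : d ≠ 0) (hP : P ∈ doublyStochastic ℝ (CoinIndex d))
    (hirr : P.IsIrreducible) :
    (P - 1) * reducedResolvent P = projQ d := by
  have hu := (isUnit_iff_isUnit_det _).1 (isUnit_projQ_mul_mul_projQ_sub_one hd hP hirr)
  have hc : Commute (P - 1) (projQ d * P * projQ d - 1) := by
    refine (Commute.sub_right ?_ (Commute.one_right _))
    refine Commute.sub_left ?_ (Commute.one_left _)
    have h : Commute P (projQ d) := (projQ_mul_comm hP).symm
    exact (h.mul_right (Commute.refl P)).mul_right h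
  -- On the range of `Q` the matrices `QPQ - 1` and `P - 1` agree, so the inverse of the former
  -- cancels the latter.
  have hPQ : (projQ d * P * projQ d - 1) * projQ d = (P - 1) * projQ d := by
    rw [sub_mul, sub_mul, projQ_mul_comm hP]
    simp only [Matrix.mul_assoc, projQ_mul_self hd]
  rw [reducedResolvent, ← Matrix.mul_assoc]
  have hc' : (P - 1) * (projQ d * P * projQ d - 1)⁻¹ = (projQ d * P * projQ d - 1)⁻¹ * (P - 1) := by
    calc (P - 1) * (projQ d * P * projQ d - 1)⁻¹
        = (projQ d * P * projQ d - 1)⁻¹ * ((projQ d * P * projQ d - 1) * (P - 1))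
          * (projQ d * P * projQ d - 1)⁻¹ := by
            rw [nonsing_inv_mul_cancel_left _ _ hu]
      _ = _ := by rw [← hc.eq, Matrix.mul_assoc, mul_nonsing_inv_cancel_right _ _ hu]
  rw [hc', Matrix.mul_assoc, ← hPQ, nonsing_inv_mul_cancel_left _ _ hu]

theorem projQ_mul_reducedResolvent (hd : d ≠ 0) (hP : P ∈ doublyStochastic ℝ (CoinIndex d))
    (hirr : P.IsIrreducible) :
    projQ d * reducedResolvent P = reducedResolvent P := by
  have hu := (isUnit_iff_isUnit_det _).1 (isUnit_projQ_mul_mul_projQ_sub_one hd hP hirr)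
  have hc : (projQ d * P * projQ d - 1) * projQ d = projQ d * (projQ d * P * projQ d - 1) := by
    rw [sub_mul, mul_sub, one_mul, mul_one]
    simp only [← Matrix.mul_assoc, projQ_mul_self hd]
    rw [Matrix.mul_assoc _ (projQ d) (projQ d), projQ_mul_self hd]
  calc projQ d * reducedResolvent P
      = (projQ d * P * projQ d - 1)⁻¹ * ((projQ d * P * projQ d - 1) * projQ d)
          * (projQ d * P * projQ d - 1)⁻¹ * projQ d := by
        rw [nonsing_inv_mul_cancel_left _ _ hu, reducedResolvent, ← Matrix.mul_assoc (projQ d)]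
    _ = reducedResolvent P := by
        rw [hc, Matrix.mul_assoc _ (projQ d * (projQ d * P * projQ d - 1)),
          mul_nonsing_inv_cancel_right _ _ hu, Matrix.mul_assoc, projQ_mul_self hd,
          reducedResolvent]

theorem reducedResolvent_mul_sub_one (hd : d ≠ 0) (hP : P ∈ doublyStochastic ℝ (CoinIndex d))
    (hirr : P.IsIrreducible) :
    reducedResolvent P * (P - 1) = projQ d := by
  have hu := (isUnit_iff_isUnit_det _).1 (isUnit_projQ_mul_mul_projQ_sub_one hd hP hirr)
  have hPQ : projQ d * (P - 1) = (projQ d * P * projQ d - 1) * projQ d := by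
    rw [sub_mul, mul_sub, one_mul, mul_one, Matrix.mul_assoc _ (projQ d) (projQ d),
      projQ_mul_self hd, projQ_mul_comm hP, Matrix.mul_assoc, projQ_mul_self hd]
  rw [reducedResolvent, Matrix.mul_assoc, hPQ, nonsing_inv_mul_cancel_left _ _ hu]

/-- Solvability of the Poisson equation. -/
theorem exists_sub_mulVec_eq (hd : d ≠ 0) (hP : P ∈ doublyStochastic ℝ (CoinIndex d))
    (hirr : P.IsIrreducible)
    {h : CoinIndex d → ℝ} (hh : ∑ x, h x = 0) :
    ∃ g : CoinIndex d → ℝ, g - P *ᵥ g = h := by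
  refine ⟨-(reducedResolvent P *ᵥ h), ?_⟩
  have h1 : ((P - 1) * reducedResolvent P) *ᵥ h = h := by
    rw [sub_one_mul_reducedResolvent hd hP hirr, projQ_mulVec_of_sum_eq_zero hh]
  rw [← mulVec_mulVec, sub_mulVec, one_mulVec] at h1
  rw [mulVec_neg]
  nth_rewrite 3 [← h1]
  abel

end Resolvent

/-! ### Chains driven by random maps -/

section Markov

variable {S : Type*} [Finite S] [MeasurableSpace S] [MeasurableSingletonClass S]
  {X : Type*} [MeasurableSpace X] {ν : Measure X}

theorem measurable_randomMap {G : X → S → S} {σ : X → S} (hG : Measurable G) (hσ : Measurable σ) :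
    Measurable fun ω => G ω (σ ω) :=
  (measurable_of_finite fun p : (S → S) × S => p.1 p.2).comp (hG.prodMk hσ)

/-- The probability of a path of a chain driven by i.i.d. random maps. -/
theorem measure_path_eq_prod {G : ℕ → X → S → S}
    (hGindep : iIndepFun G ν) {τ : ℕ → X → S} (hτ : ∀ k ω, τ (k + 1) ω = G k ω (τ k ω))
    (hindep : IndepFun (τ 0) (fun ω k => G k ω) ν) (n : ℕ) (s : ℕ → S) :
    ν {ω | ∀ k ≤ n, τ k ω = s k}
      = ν {ω | τ 0 ω = s 0} * ∏ k ∈ Finset.range n, ν {ω | G k ω (s k) = s (k + 1)} := by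
  -- Once the path is prescribed, each map is evaluated only at the deterministic point `s k`, so
  -- independence factorises the event.
  have hset : {ω | ∀ k ≤ n, τ k ω = s k} = {ω | τ 0 ω = s 0} ∩
      {ω | ∀ k ∈ Finset.range n, G k ω (s k) = s (k + 1)} := by
    ext ω
    simp only [Set.mem_ofPred_eq, Set.mem_inter_iff, Finset.mem_range]
    constructor
    · intro h
      refine ⟨h 0 (Nat.zero_le n), fun k hk => ?_⟩
      rw [← h k hk.le, ← hτ, h (k + 1) hk]
    · rintro ⟨h0, h1⟩ k hk
      induction k with
      | zero => exact h0
      | succ k ih => rw [hτ, ih (by omega), h1 k (by omega)]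
  have hm (k : ℕ) : MeasurableSet {g : S → S | g (s k) = s (k + 1)} := Set.toFinite _ |>.measurableSet
  have hm' : MeasurableSet {g : ℕ → S → S | ∀ k ∈ Finset.range n, g k (s k) = s (k + 1)} := by
    have : {g : ℕ → S → S | ∀ k ∈ Finset.range n, g k (s k) = s (k + 1)}
        = ⋂ k ∈ Finset.range n, (fun g : ℕ → S → S => g k) ⁻¹' {g : S → S | g (s k) = s (k + 1)} := by
      ext g
      simp
    rw [this]
    exact Finset.measurableSet_biInter _ fun k _ => measurable_pi_apply k (hm k)
  have h1 := hindep.measure_inter_preimage_eq_mul {s 0} _ (measurableSet_singleton _) hm'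
  have h2 := hGindep.measure_inter_preimage_eq_mul (Finset.range n)
    (sets := fun k => {g : S → S | g (s k) = s (k + 1)}) fun k _ => hm k
  rw [hset]
  refine h1.trans ?_
  congr 1
  refine (congrArg ν ?_).trans h2
  ext ω
  simp

/-- A chain driven by i.i.d. random maps is a Markov chain. -/
theorem isMarkovChain_of_randomMap [IsProbabilityMeasure ν] {G : ℕ → X → S → S} (hG : ∀ k, Measurable (G k))
    (hGindep : iIndepFun G ν) {τ : ℕ → X → S} (hτ0 : Measurable (τ 0))
    (hτ : ∀ k ω, τ (k + 1) ω = G k ω (τ k ω))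
    (hindep : IndepFun (τ 0) (fun ω k => G k ω) ν) {P : Matrix S S ℝ}
    (hP : ∀ k x y, ν.real {ω | G k ω x = y} = P x y) :
    IsMarkovChain ν τ (fun s => ν.real {ω | τ 0 ω = s}) P := by
  have hmeas (n : ℕ) : Measurable (τ n) := by
    induction n with
    | zero => exact hτ0
    | succ n ih => exact funext (hτ n) ▸ measurable_randomMap (hG n) ih
  refine ⟨hmeas, fun s => rfl, fun n s t hne => ?_⟩
  have hA : MeasurableSet {ω | ∀ k ≤ n, τ k ω = s k} := by
    have : {ω | ∀ k ≤ n, τ k ω = s k} = ⋂ k ∈ Finset.Iic n, τ k ⁻¹' {s k} := by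
      ext ω
      simp
    rw [this]
    exact Finset.measurableSet_biInter _ fun k _ => hmeas k (measurableSet_singleton _)
  have hpath := measure_path_eq_prod hGindep hτ hindep
  -- Overwriting `s` at time `n + 1` by `t` makes the joint event a path event, to which the product
  -- formula applies.
  have hcap : {ω | ∀ k ≤ n, τ k ω = s k} ∩ {ω | τ (n + 1) ω = t}
      = {ω | ∀ k ≤ n + 1, τ k ω = Function.update s (n + 1) t k} := by
    ext ω
    simp only [Set.mem_inter_iff, Set.mem_ofPred_eq]
    constructor
    · rintro ⟨h1, h2⟩ k hk
      rcases Nat.le_succ_iff.1 hk with h | rfl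
      · rw [Function.update_of_ne (by omega), h1 k h]
      · rw [Function.update_self, h2]
    · intro h
      refine ⟨fun k hk => ?_, ?_⟩
      · rw [h k (by omega), Function.update_of_ne (by omega)]
      · rw [h (n + 1) le_rfl, Function.update_self]
  have hmul : ν ({ω | ∀ k ≤ n, τ k ω = s k} ∩ {ω | τ (n + 1) ω = t})
      = ν {ω | ∀ k ≤ n, τ k ω = s k} * ν {ω | G n ω (s n) = t} := by
    rw [hcap, hpath, hpath, Finset.prod_range_succ, Function.update_self,
      Function.update_of_ne (by omega), Function.update_of_ne (by omega), mul_assoc]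
    congr 2
    refine Finset.prod_congr rfl fun k hk => ?_
    have := Finset.mem_range.1 hk
    rw [Function.update_of_ne (by omega), Function.update_of_ne (by omega)]
  rw [← hP n, measureReal_def, measureReal_def, cond_apply hA, hmul,
    ENNReal.inv_mul_cancel_left hne (measure_ne_top _ _)]

theorem integrable_comp_of_finite [IsFiniteMeasure ν] {T E : Type*} [Finite T] [MeasurableSpace T]
    [MeasurableSingletonClass T] [NormedAddCommGroup E] {Y : X → T} (hY : Measurable Y)
    (g : T → E) : Integrable (fun ω => g (Y ω)) ν :=
  (Integrable.of_finite (μ := ν.map Y) (f := g)).comp_measurable hY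

theorem integral_comp_eq_sum [IsProbabilityMeasure ν] {T E : Type*} [Fintype T] [MeasurableSpace T]
    [MeasurableSingletonClass T] [NormedAddCommGroup E] [NormedSpace ℝ E] [CompleteSpace E]
    {Y : X → T} (hY : Measurable Y) (g : T → E) :
    ∫ ω, g (Y ω) ∂ν = ∑ y, ν.real {ω | Y ω = y} • g y := by
  have : IsProbabilityMeasure (ν.map Y) := Measure.isProbabilityMeasure_map hY.aemeasurable
  rw [← integral_map hY.aemeasurable AEStronglyMeasurable.of_discrete,
    integral_fintype Integrable.of_finite]
  refine Finset.sum_congr rfl fun y _ => ?_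
  rw [map_measureReal_apply hY (measurableSet_singleton y)]
  rfl

end Markov

/-! ### Second moments and the law of large numbers -/

theorem dependsOn_sum {S : Type*} (f : S → ℝ) (n : ℕ) :
    DependsOn (fun s : ℕ → S => ∑ j ∈ Finset.Icc 1 n, f (s j)) (Set.Iic n) :=
  fun s t hst => Finset.sum_congr rfl fun j hj => by rw [hst j (Finset.mem_Icc.1 hj).2]

namespace IsMarkovChain

variable {S : Type*} [Fintype S] [MeasurableSpace S] [MeasurableSingletonClass S]
  {X : Type*} [MeasurableSpace X] {ν : Measure X} [IsProbabilityMeasure ν]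
  {τ : ℕ → X → S} {p₀ : S → ℝ} {P : Matrix S S ℝ}

/-- A function of the times up to `n` takes finitely many values along the chain. -/
theorem integrable_path (h : IsMarkovChain ν τ p₀ P) {E : Type*} [NormedAddCommGroup E] {n : ℕ}
    {F : (ℕ → S) → E} (hF : DependsOn F (Set.Iic n)) :
    Integrable (fun ω => F fun k => τ k ω) ν := by
  have hY : Measurable fun ω (k : Fin (n + 1)) => τ k ω :=
    measurable_pi_lambda _ fun k => h.measurable k
  have := integrable_comp_of_finite (ν := ν) hY fun y => F fun k => y (Fin.ofNat (n + 1) k)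
  refine this.congr (ae_of_all _ fun ω => hF fun k hk => ?_)
  simp [Nat.mod_eq_of_lt (Nat.lt_succ_of_le hk)]

/-- The Markov property, integrated against a function of the past. -/
theorem integral_mul_comp_succ (h : IsMarkovChain ν τ p₀ P) {𝕜 : Type*} [RCLike 𝕜] {n : ℕ}
    {F : (ℕ → S) → 𝕜} (hF : DependsOn F (Set.Iic n)) (φ : S → 𝕜) :
    ∫ ω, F (fun k => τ k ω) * φ (τ (n + 1) ω) ∂ν
      = ∫ ω, F (fun k => τ k ω) * ∑ t, (P (τ n ω) t : 𝕜) * φ t ∂ν := by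
  -- A finite history is extended to a full sequence periodically (indices modulo `n + 1`); only the
  -- values up to time `n` matter.
  let e : (Fin (n + 1) → S) → ℕ → S := fun y k => y (Fin.ofNat (n + 1) k)
  let Y : X → Fin (n + 1) → S := fun ω k => τ k ω
  have hY : Measurable Y := measurable_pi_lambda _ fun k => h.measurable k
  have he (ω : X) (k : ℕ) (hk : k ≤ n) : e (Y ω) k = τ k ω := by
    simp [e, Y, Nat.mod_eq_of_lt (Nat.lt_succ_of_le hk)]
  have hFe (ω : X) : F (fun k => τ k ω) = F (e (Y ω)) := hF fun k hk => (he ω k hk).symm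
  have hL : ∫ ω, F (fun k => τ k ω) * φ (τ (n + 1) ω) ∂ν = _ :=
    (integral_congr_ae (ae_of_all _ fun ω => by simp only [hFe])).trans
      (integral_comp_eq_sum (ν := ν) (hY.prodMk (h.measurable (n + 1)))
        fun p : (Fin (n + 1) → S) × S => F (e p.1) * φ p.2)
  have hR : ∫ ω, F (fun k => τ k ω) * ∑ t, (P (τ n ω) t : 𝕜) * φ t ∂ν = _ :=
    (integral_congr_ae (ae_of_all _ fun ω => by simp only [hFe, ← he ω n le_rfl])).trans
      (integral_comp_eq_sum (ν := ν) hY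
        fun y => F (e y) * ∑ t, (P (e y n) t : 𝕜) * φ t)
  rw [hL, hR, Fintype.sum_prod_type]
  refine Finset.sum_congr rfl fun y _ => ?_
  have hset : {ω | Y ω = y} = {ω | ∀ k ≤ n, τ k ω = e y k} := by
    ext ω
    constructor
    · rintro rfl k hk
      exact (he ω k hk).symm
    · intro hk
      ext k
      have := hk k (Nat.lt_succ_iff.1 k.2)
      simpa [e, Y] using this
  have hjoint (t : S) : ν.real {ω | (Y ω, τ (n + 1) ω) = (y, t)}
      = ν.real {ω | Y ω = y} * P (e y n) t := by
    have hcap : {ω | (Y ω, τ (n + 1) ω) = (y, t)} = {ω | Y ω = y} ∩ {ω | τ (n + 1) ω = t} := by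
      ext ω
      simp
    -- The transition law is prescribed only after non-null histories; on null ones both sides
    -- vanish.
    by_cases h0 : ν {ω | Y ω = y} = 0
    · rw [hcap, measureReal_def, measureReal_def, h0, measure_mono_null Set.inter_subset_left h0]
      simp
    · have h1 := h.transition n (e y) t (hset ▸ h0)
      have hm : MeasurableSet {ω | Y ω = y} := hY (measurableSet_singleton y)
      rw [← hset, measureReal_def, cond_apply hm, ENNReal.toReal_mul] at h1
      rw [hcap, ← h1, measureReal_def, measureReal_def, ENNReal.toReal_inv, mul_inv_cancel_left₀]
      exact ENNReal.toReal_ne_zero.2 ⟨h0, measure_ne_top _ _⟩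
  simp only [hjoint, Finset.mul_sum, Finset.smul_sum, RCLike.real_smul_eq_coe_mul]
  refine Finset.sum_congr rfl fun t _ => ?_
  push_cast
  ring

/-- The additive functional of a centred function has second moment of linear growth. -/
theorem integral_sum_sq_le (h : IsMarkovChain ν τ p₀ P) {f g : S → ℝ}
    (hg : ∀ x, ∑ t, P x t * (f t + g t) = g x) :
    ∃ K : ℝ, 0 ≤ K ∧ ∀ n : ℕ, ∫ ω, (∑ j ∈ Finset.Icc 1 n, f (τ j ω)) ^ 2 ∂ν ≤ K * (n + 1) := by
  obtain ⟨K₁, hK₁⟩ : ∃ K₁ : ℝ, ∀ x, ∑ t, P x t * (f t ^ 2 + 2 * f t * g t) ≤ K₁ :=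
    (Set.finite_range _).bddAbove.imp fun K hK x => hK (Set.mem_range_self x)
  obtain ⟨K₂, hK₂⟩ : ∃ K₂ : ℝ, ∀ x, g x ^ 2 ≤ K₂ :=
    (Set.finite_range _).bddAbove.imp fun K hK x => hK (Set.mem_range_self x)
  have hX : Nonempty X := nonempty_of_isProbabilityMeasure ν
  have hK₂0 : 0 ≤ K₂ := (sq_nonneg _).trans (hK₂ (τ 0 hX.some))
  let W (n : ℕ) (s : ℕ → S) : ℝ := ∑ j ∈ Finset.Icc 1 n, f (s j)
  have hW (n : ℕ) : DependsOn (W n) (Set.Iic n) := dependsOn_sum f n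
  have hW' (n : ℕ) {s t : ℕ → S} (hst : ∀ i ∈ Set.Iic n, s i = t i) : W n s = W n t := hW n hst
  -- The cross term with `g` makes the recursion close: by `P (f + g) = g`, one step adds only the
  -- expectation of `P (f ^ 2 + 2 f g)`, which is at most `K₁`.
  let A (n : ℕ) : ℝ := ∫ ω, (W n fun k => τ k ω) ^ 2 + 2 * (W n fun k => τ k ω) * g (τ n ω) ∂ν
  have hi {n : ℕ} {F : (ℕ → S) → ℝ} (hF : DependsOn F (Set.Iic n)) := h.integrable_path hF
  have hstep (n : ℕ) : A (n + 1) ≤ A n + K₁ := by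
    have hWs (s : ℕ → S) : W (n + 1) s = W n s + f (s (n + 1)) :=
      Finset.sum_Icc_succ_top (by omega) _
    have hD2 : DependsOn (fun s => W n s ^ 2) (Set.Iic n) := fun s t hst => by
      simp only [hW' n hst]
    have hD1 : DependsOn (fun s => 2 * W n s) (Set.Iic n) := fun s t hst => by
      simp only [hW' n hst]
    have e1 := h.integral_mul_comp_succ hD1 fun t => f t + g t
    have e2 := h.integral_mul_comp_succ (𝕜 := ℝ) (n := n) (F := fun _ => 1) (fun _ _ _ => rfl)
      fun t => f t ^ 2 + 2 * f t * g t
    simp only [RCLike.ofReal_real_eq_id, id, hg, one_mul] at e1 e2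
    have i1 : Integrable (fun ω => (W n fun k => τ k ω) ^ 2) ν := hi hD2
    have i2 : Integrable (fun ω => 2 * (W n fun k => τ k ω) * (f (τ (n + 1) ω) + g (τ (n + 1) ω))) ν :=
      hi (n := n + 1) (F := fun s => 2 * W n s * (f (s (n + 1)) + g (s (n + 1))))
        fun s t hst => by
          simp only [hW' n fun i hi => hst i (le_trans hi (Nat.le_succ n)),
            hst (n + 1) (Set.mem_Iic.2 le_rfl)]
    have i12 : Integrable (fun ω => (W n fun k => τ k ω) ^ 2
        + 2 * (W n fun k => τ k ω) * (f (τ (n + 1) ω) + g (τ (n + 1) ω))) ν := i1.add i2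
    have i3 : Integrable (fun ω => f (τ (n + 1) ω) ^ 2 + 2 * f (τ (n + 1) ω) * g (τ (n + 1) ω)) ν :=
      integrable_comp_of_finite (h.measurable (n + 1)) fun t => f t ^ 2 + 2 * f t * g t
    have i4 : Integrable (fun ω => 2 * (W n fun k => τ k ω) * g (τ n ω)) ν :=
      hi (n := n) (F := fun s => 2 * W n s * g (s n)) fun s t hst => by
          simp only [hW' n hst, hst n (Set.mem_Iic.2 le_rfl)]
    have i5 : Integrable (fun ω => ∑ t, P (τ n ω) t * (f t ^ 2 + 2 * f t * g t)) ν :=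
      integrable_comp_of_finite (h.measurable n) fun x => ∑ t, P x t * (f t ^ 2 + 2 * f t * g t)
    have e3 : A (n + 1) = ∫ ω, (W n fun k => τ k ω) ^ 2
        + 2 * (W n fun k => τ k ω) * (f (τ (n + 1) ω) + g (τ (n + 1) ω))
        + (f (τ (n + 1) ω) ^ 2 + 2 * f (τ (n + 1) ω) * g (τ (n + 1) ω)) ∂ν :=
      integral_congr_ae (ae_of_all _ fun ω => by simp only [hWs]; ring)
    have e4 : A n = _ := integral_add i1 i4
    rw [e3, integral_add i12 i3, integral_add i1 i2, e1, e2, e4]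
    gcongr
    calc ∫ ω, ∑ t, P (τ n ω) t * (f t ^ 2 + 2 * f t * g t) ∂ν ≤ ∫ _, K₁ ∂ν :=
          integral_mono i5 (integrable_const _) fun ω => hK₁ _
      _ = K₁ := by simp
  have hA (n : ℕ) : A n ≤ n * K₁ := by
    induction n with
    | zero => simp [A, W]
    | succ n ih =>
      push_cast
      linarith [hstep n]
  -- The cross term is removed by `W ^ 2 ≤ 2 (W ^ 2 + 2 W g) + 4 g ^ 2`, that is, `(W + 2 g) ^ 2 ≥
  -- 0`.
  refine ⟨2 * |K₁| + 4 * K₂, by positivity, fun n => ?_⟩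
  have hD2 : DependsOn (fun s => W n s ^ 2) (Set.Iic n) := fun s t hst => by
    simp only [hW' n hst]
  have i6 : Integrable (fun ω => (W n fun k => τ k ω) ^ 2 + 2 * (W n fun k => τ k ω) * g (τ n ω)) ν :=
    hi (n := n) (F := fun s => W n s ^ 2 + 2 * W n s * g (s n)) fun s t hst => by
      simp only [hW' n hst, hst n (Set.mem_Iic.2 le_rfl)]
  calc ∫ ω, (W n fun k => τ k ω) ^ 2 ∂ν
      ≤ ∫ ω, 2 * ((W n fun k => τ k ω) ^ 2 + 2 * (W n fun k => τ k ω) * g (τ n ω)) + 4 * K₂ ∂ν := by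
        refine integral_mono (hi hD2) ((i6.const_mul 2).add (integrable_const _)) fun ω => ?_
        have := hK₂ (τ n ω)
        dsimp only
        nlinarith [sq_nonneg ((W n fun k => τ k ω) + 2 * g (τ n ω))]
    _ = 2 * A n + 4 * K₂ := by
        rw [integral_add (i6.const_mul 2) (integrable_const _), integral_const_mul]
        simp [A]
    _ ≤ (2 * |K₁| + 4 * K₂) * (n + 1) := by
        have h1 : (n : ℝ) * K₁ ≤ n * |K₁| := by gcongr; exact le_abs_self _
        have h2 : (0 : ℝ) ≤ n * K₂ := by positivity
        nlinarith [hA n, abs_nonneg K₁]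

/-- The law of large numbers for a centred function. -/
theorem ae_tendsto_sum_div (h : IsMarkovChain ν τ p₀ P) {f g : S → ℝ}
    (hg : ∀ x, ∑ t, P x t * (f t + g t) = g x) :
    ∀ᵐ ω ∂ν, Tendsto (fun n : ℕ => (∑ j ∈ Finset.Icc 1 n, f (τ j ω)) / n) atTop (𝓝 0) := by
  obtain ⟨K, hK0, hK⟩ := h.integral_sum_sq_le hg
  obtain ⟨C, hC⟩ : ∃ C : ℝ, ∀ x, -f x ≤ C :=
    (Set.finite_range _).bddAbove.imp fun K hK x => hK (Set.mem_range_self x)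
  -- Along squares the second moments of the averages are summable; the shift keeps the denominator
  -- positive.
  let c (n : ℕ) : ℕ := (n + 1) ^ 2
  let V (n : ℕ) (ω : X) : ℝ := (∑ j ∈ Finset.Icc 1 (c n), f (τ j ω)) / c n
  have hVi (n : ℕ) : Integrable (fun ω => V n ω ^ 2) ν :=
    h.integrable_path (n := c n) (F := fun s => ((∑ j ∈ Finset.Icc 1 (c n), f (s j)) / c n) ^ 2)
      fun s t hst => by
        have := dependsOn_sum f (c n) hst
        simp only at this
        simp only [this]
  have hV (n : ℕ) : ∫⁻ ω, ENNReal.ofReal (V n ω ^ 2) ∂ν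
      ≤ ENNReal.ofReal (2 * K * (1 / ((n : ℝ) + 1) ^ 2)) := by
    rw [← ofReal_integral_eq_lintegral_ofReal (hVi n) (ae_of_all _ fun ω => sq_nonneg _)]
    refine ENNReal.ofReal_le_ofReal ?_
    simp only [V, div_pow, integral_div]
    have hcpos : (0 : ℝ) < c n := by simp only [c]; positivity
    have h1 : (1 : ℝ) ≤ c n := by exact_mod_cast hcpos
    have hcn : (c n : ℝ) = ((n : ℝ) + 1) ^ 2 := by simp [c]
    rw [← hcn, div_le_iff₀ (by positivity)]
    calc _ ≤ K * (c n + 1) := hK (c n)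
      _ ≤ K * (2 * c n) := by gcongr; linarith
      _ = _ := by field_simp
  have hsum : ∑' n, ∫⁻ ω, ENNReal.ofReal (V n ω ^ 2) ∂ν ≠ ⊤ := by
    refine ne_top_of_le_ne_top ?_ (ENNReal.tsum_le_tsum hV)
    refine Summable.tsum_ofReal_ne_top (Summable.mul_left _ ?_)
    have := (summable_nat_add_iff 1).2 (Real.summable_one_div_nat_pow.2 one_lt_two)
    simpa using this
  have hae : ∀ᵐ ω ∂ν, ∑' n, ENNReal.ofReal (V n ω ^ 2) < ⊤ := by
    have hm (n : ℕ) : AEMeasurable (fun ω => ENNReal.ofReal (V n ω ^ 2)) ν :=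
      (hVi n).aemeasurable.ennreal_ofReal
    refine ae_lt_top' (AEMeasurable.tsum hm) ?_
    rwa [lintegral_tsum hm]
  filter_upwards [hae] with ω hω
  have hsq : Tendsto (fun n => V n ω ^ 2) atTop (𝓝 0) := by
    have h0 := ENNReal.tendsto_atTop_zero_of_tsum_ne_top hω.ne
    have h1 := (ENNReal.tendsto_toReal ENNReal.zero_ne_top).comp h0
    refine Tendsto.congr (fun n => ?_) h1
    simp [ENNReal.toReal_ofReal (sq_nonneg (V n ω))]
  have hV0 : Tendsto (fun n => V n ω) atTop (𝓝 0) := by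
    rw [tendsto_zero_iff_abs_tendsto_zero]
    have h2 := hsq.sqrt
    simp only [Real.sqrt_sq_eq_abs, Real.sqrt_zero] at h2
    exact h2
  -- Adding `C ≥ -f` makes the partial sums monotone, so convergence passes from the squares, whose
  -- consecutive ratios tend to `1`, to all `n`.
  let u (n : ℕ) : ℝ := ∑ j ∈ Finset.Icc 1 n, (f (τ j ω) + C)
  have hu (n : ℕ) : u n = ∑ j ∈ Finset.Icc 1 n, f (τ j ω) + n * C := by
    simp [u, Finset.sum_add_distrib]
  have hmono : Monotone u := monotone_nat_of_le_succ fun n => by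
    simp only [u]
    rw [Finset.sum_Icc_succ_top (by omega)]
    linarith [hC (τ (n + 1) ω)]
  have hc : Tendsto c atTop atTop :=
    (tendsto_pow_atTop two_ne_zero).comp (tendsto_add_atTop_nat 1)
  have hlim := tendsto_div_of_monotone_of_exists_subseq_tendsto_div u C hmono fun a ha => by
    refine ⟨c, ?_, hc, ?_⟩
    · have h1 : Tendsto (fun n : ℕ => (1 + 1 / ((n : ℝ) + 1)) ^ 2) atTop (𝓝 1) := by
        simpa using (tendsto_one_div_add_atTop_nhds_zero_nat.const_add (1 : ℝ)).pow 2
      filter_upwards [h1.eventually_lt_const ha] with n hn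
      have h2 : (c (n + 1) : ℝ) = (1 + 1 / ((n : ℝ) + 1)) ^ 2 * c n := by
        simp only [c]
        push_cast
        field_simp
      rw [h2]
      gcongr
    · have h3 := hV0.add_const C
      rw [zero_add] at h3
      refine h3.congr fun n => ?_
      have hcpos : (c n : ℝ) ≠ 0 := by simp only [c]; positivity
      simp only [hu, V]
      field_simp
  have h4 := hlim.sub_const C
  rw [sub_self] at h4
  refine h4.congr' ?_
  filter_upwards [eventually_gt_atTop 0] with n hn
  have : (n : ℝ) ≠ 0 := by positivity
  simp only [hu]
  field_simp
  ring

end IsMarkovChain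

/-! ### Second-order perturbation of the transition operator -/

open Complex Asymptotics

theorem exp_I_mul_sub_isBigO (a : ℝ) :
    (fun s : ℝ => cexp (I * (s * a)) - (1 + I * (s * a) - s ^ 2 * a ^ 2 / 2))
      =O[𝓝 0] fun s : ℝ => s ^ 3 := by
  have hc : Continuous fun s : ℝ => I * (s * a : ℂ) := by fun_prop
  have ht : Tendsto (fun s : ℝ => I * (s * a : ℂ)) (𝓝 0) (𝓝 0) := by
    simpa using hc.tendsto 0
  have h := (Complex.exp_sub_sum_range_isBigO_pow 3).comp_tendsto ht
  refine (h.congr_left fun s => ?_).trans ?_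
  · simp only [Function.comp, Finset.sum_range_succ, Finset.sum_range_zero, Nat.factorial]
    push_cast
    linear_combination (-(s : ℂ) ^ 2 * a ^ 2 / 2) * I_sq
  · refine IsBigO.of_bound (|a| ^ 3) (Eventually.of_forall fun s => ?_)
    simp only [Function.comp, norm_pow, norm_mul, norm_I, one_mul, norm_real, Real.norm_eq_abs]
    exact le_of_eq (by ring)

theorem exp_neg_mul_sq_sub_isBigO (v : ℝ) :
    (fun s : ℝ => cexp (-(v / 2 * s ^ 2)) - (1 - v / 2 * s ^ 2)) =O[𝓝 0] fun s : ℝ => s ^ 3 := by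
  have hc : Continuous fun s : ℝ => (-(v / 2 * s ^ 2) : ℂ) := by fun_prop
  have ht : Tendsto (fun s : ℝ => (-(v / 2 * s ^ 2) : ℂ)) (𝓝 0) (𝓝 0) := by
    simpa using hc.tendsto 0
  have h := (Complex.exp_sub_sum_range_isBigO_pow 2).comp_tendsto ht
  refine (h.congr_left fun s => ?_).trans (IsBigO.trans (g := fun s : ℝ => s ^ 4) ?_ ?_)
  · simp only [Function.comp, Finset.sum_range_succ, Finset.sum_range_zero, Nat.factorial]
    push_cast
    ring
  · refine IsBigO.of_bound ((|v| / 2) ^ 2) (Eventually.of_forall fun s => ?_)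
    simp only [Function.comp, norm_pow, norm_mul, norm_neg, norm_real, Real.norm_eq_abs, norm_div,
      Complex.norm_ofNat]
    exact le_of_eq (by ring)
  · exact (isLittleO_pow_pow (𝕜 := ℝ) (by norm_num : 3 < 4)).isBigO

theorem exists_uniform_bound {S : Type*} [Finite S] {F : S → ℝ → ℂ} {g : ℝ → ℝ}
    (h : ∀ x, F x =O[𝓝 0] g) :
    ∃ K : ℝ, 0 ≤ K ∧ ∀ᶠ s in 𝓝 0, ∀ x, ‖F x s‖ ≤ K * ‖g s‖ := by
  choose k hk using fun x => (h x).bound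
  obtain ⟨K, hK⟩ := (Set.finite_range k).bddAbove
  refine ⟨max K 0, le_max_right _ _, (eventually_all.2 hk).mono fun s hs x => (hs x).trans ?_⟩
  gcongr
  exact (hK (Set.mem_range_self x)).trans (le_max_left _ _)

section Perturbation

variable {S : Type*} [Fintype S] {P : Matrix S S ℝ} {f g₁ g₂ : S → ℝ} {v : ℝ}

/-- The approximate eigenfunction of the perturbed transition operator. -/
noncomputable def approxEigenfunction {S : Type*} (g₁ g₂ : S → ℝ) (s : ℝ) (x : S) : ℂ := 1 + I * (s * g₁ x) + s ^ 2 * g₂ x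

theorem approxEigenfunction_sub_one_isBigO {S : Type*} (g₁ g₂ : S → ℝ) (x : S) :
    (fun s : ℝ => approxEigenfunction g₁ g₂ s x - 1) =O[𝓝 0] fun s : ℝ => s := by
  have hc : Continuous fun s : ℝ => (I * g₁ x + s * g₂ x : ℂ) := by fun_prop
  have hs : (fun s : ℝ => (s : ℂ)) =O[𝓝 0] fun s : ℝ => s := 
    Complex.isBigO_ofReal_left.2 (isBigO_refl _ _)
  refine ((hs.mul ((hc.tendsto 0).isBigO_one ℝ)).congr_left fun s => ?_).congr_right fun s => ?_
  · simp only [approxEigenfunction]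
    ring
  · ring

/-- The three hypotheses are exactly the cancellation of the coefficients of `s ^ 0`, `s ^ 1` and `s
^ 2`. -/
theorem approxEigenfunction_isBigO (hrow : ∀ x, ∑ t, P x t = 1)
    (hg₁ : ∀ x, ∑ t, P x t * (f t + g₁ t) = g₁ x)
    (hg₂ : ∀ x, ∑ t, P x t * (f t ^ 2 / 2 + f t * g₁ t - g₂ t) = v / 2 - g₂ x) (x : S) :
    (fun s : ℝ => ∑ t, (P x t : ℂ) * (cexp (I * (s * f t)) * approxEigenfunction g₁ g₂ s t)
      - cexp (-(v / 2 * s ^ 2)) * approxEigenfunction g₁ g₂ s x) =O[𝓝 0] fun s : ℝ => s ^ 3 := by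
  have hu (t : S) : (fun s : ℝ => approxEigenfunction g₁ g₂ s t) =O[𝓝 0] fun _ => (1 : ℝ) := by
    have hc : Continuous fun s : ℝ => approxEigenfunction g₁ g₂ s t := by
      unfold approxEigenfunction
      fun_prop
    exact (hc.tendsto 0).isBigO_one ℝ
  have h1 : (fun s : ℝ => ∑ t, (P x t : ℂ) *
      ((cexp (I * (s * f t)) - (1 + I * (s * f t) - s ^ 2 * f t ^ 2 / 2))
        * approxEigenfunction g₁ g₂ s t)) =O[𝓝 0] fun s : ℝ => s ^ 3 := by
    refine IsBigO.fun_sum fun t _ => ?_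
    simpa using ((exp_I_mul_sub_isBigO (f t)).mul (hu t)).const_mul_left (P x t : ℂ)
  have h2 : (fun s : ℝ => (cexp (-(v / 2 * s ^ 2)) - (1 - v / 2 * s ^ 2))
      * approxEigenfunction g₁ g₂ s x) =O[𝓝 0] fun s : ℝ => s ^ 3 := by
    simpa using (exp_neg_mul_sq_sub_isBigO v).mul (hu x)
  -- The coefficients of `s ^ 3` and `-s ^ 4` left over from multiplying the Taylor polynomials by
  -- the approximate eigenfunction.
  let c₃ : ℂ := ∑ t, (P x t : ℂ) * (I * f t * g₂ t - I * f t ^ 2 * g₁ t / 2) + v / 2 * I * g₁ x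
  let c₄ : ℂ := ∑ t, (P x t : ℂ) * (f t ^ 2 * g₂ t / 2) - v / 2 * g₂ x
  have h3 : (fun s : ℝ => (s : ℂ) ^ 3 * (c₃ - s * c₄)) =O[𝓝 0] fun s : ℝ => s ^ 3 := by
    have hc : Continuous fun s : ℝ => c₃ - s * c₄ := by fun_prop
    have hs : (fun s : ℝ => (s : ℂ) ^ 3) =O[𝓝 0] fun s : ℝ => s ^ 3 := by
      have := Complex.isBigO_ofReal_left.2 (isBigO_refl (fun s : ℝ => s ^ 3) (𝓝 0))
      simpa only [ofReal_pow] using this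
    simpa using hs.mul ((hc.tendsto 0).isBigO_one ℝ)
  refine ((h1.sub h2).add h3).congr_left fun s => ?_
  have e0 : ∑ t, (P x t : ℂ) = 1 := by exact_mod_cast hrow x
  have e1 : ∑ t, (P x t : ℂ) * (f t + g₁ t) = g₁ x := by exact_mod_cast hg₁ x
  have e2 : ∑ t, (P x t : ℂ) * ((f t : ℂ) ^ 2 / 2 + f t * g₁ t - g₂ t) = (v / 2 - g₂ x : ℂ) := by
    have := congrArg (fun y : ℝ => (y : ℂ)) (hg₂ x)
    push_cast at this
    exact this
  have key : ∑ t, (P x t : ℂ) * ((1 + I * (s * f t) - s ^ 2 * f t ^ 2 / 2)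
        * approxEigenfunction g₁ g₂ s t)
      = ∑ t, (P x t : ℂ) + I * s * ∑ t, (P x t : ℂ) * (f t + g₁ t)
        - s ^ 2 * ∑ t, (P x t : ℂ) * (f t ^ 2 / 2 + f t * g₁ t - g₂ t)
        + s ^ 3 * ∑ t, (P x t : ℂ) * (I * f t * g₂ t - I * f t ^ 2 * g₁ t / 2)
        - s ^ 4 * ∑ t, (P x t : ℂ) * (f t ^ 2 * g₂ t / 2) := by
    simp only [Finset.mul_sum, ← Finset.sum_add_distrib, ← Finset.sum_sub_distrib]
    refine Finset.sum_congr rfl fun t _ => ?_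
    simp only [approxEigenfunction]
    linear_combination ((P x t : ℂ) * s ^ 2 * f t * g₁ t) * I_sq
  rw [e0, e1, e2] at key
  have hsplit : ∑ t, (P x t : ℂ) *
      ((cexp (I * (s * f t)) - (1 + I * (s * f t) - s ^ 2 * f t ^ 2 / 2))
        * approxEigenfunction g₁ g₂ s t)
      = ∑ t, (P x t : ℂ) * (cexp (I * (s * f t)) * approxEigenfunction g₁ g₂ s t)
        - ∑ t, (P x t : ℂ) * ((1 + I * (s * f t) - s ^ 2 * f t ^ 2 / 2)
        * approxEigenfunction g₁ g₂ s t) := by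
    rw [← Finset.sum_sub_distrib]
    exact Finset.sum_congr rfl fun t _ => by ring
  rw [hsplit, key]
  simp only [c₃, c₄, approxEigenfunction]
  ring

end Perturbation

/-! ### The scalar central limit theorem -/

namespace IsMarkovChain

variable {S : Type*} [Fintype S] [MeasurableSpace S] [MeasurableSingletonClass S]
  {X : Type*} [MeasurableSpace X] {ν : Measure X} [IsProbabilityMeasure ν]
  {τ : ℕ → X → S} {p₀ : S → ℝ} {P : Matrix S S ℝ}

/-- Inserting `u (τ n)` under the expectation gives a quantity that one step multiplies by `l` up to
`ε₂`. Since `‖l‖ ≤ 1`, the errors merely add; replacing `u` by `1` at time `0` and at time `n` costs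
`ε₁` each. -/
theorem norm_integral_exp_sub_pow_le (h : IsMarkovChain ν τ p₀ P) {f : S → ℝ} {s : ℝ} {u : S → ℂ}
    {l : ℂ} (hl : ‖l‖ ≤ 1) {ε₁ ε₂ : ℝ} (h₁ : ∀ x, ‖u x - 1‖ ≤ ε₁)
    (h₂ : ∀ x, ‖∑ t, (P x t : ℂ) * (cexp (I * (s * f t)) * u t) - l * u x‖ ≤ ε₂) (n : ℕ) :
    ‖∫ ω, cexp (I * (s * (∑ j ∈ Finset.Icc 1 n, f (τ j ω) : ℝ))) ∂ν - l ^ n‖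
      ≤ 2 * ε₁ + n * ε₂ := by
  let E (n : ℕ) (x : ℕ → S) : ℂ := cexp (I * (s * (∑ j ∈ Finset.Icc 1 n, f (x j) : ℝ)))
  have hE (n : ℕ) : DependsOn (E n) (Set.Iic n) := fun x y hxy => by
    have := dependsOn_sum f n hxy
    simp only at this
    simp only [E, this]
  have hEnorm (n : ℕ) (x : ℕ → S) : ‖E n x‖ = 1 := by
    simp only [E]
    rw [mul_comm, ← ofReal_mul, norm_exp_ofReal_mul_I]
  have hint (n : ℕ) (φ : S → ℂ) : Integrable (fun ω => E n (fun k => τ k ω) * φ (τ n ω)) ν :=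
    h.integrable_path (n := n) (F := fun x => E n x * φ (x n)) fun x y hxy => by
      simp only [hE n hxy, hxy n (Set.mem_Iic.2 le_rfl)]
  have hbd (n : ℕ) {φ : S → ℂ} {ε : ℝ} (hφ : ∀ x, ‖φ x‖ ≤ ε) :
      ‖∫ ω, E n (fun k => τ k ω) * φ (τ n ω) ∂ν‖ ≤ ε := by
    refine (norm_integral_le_of_norm_le_const (C := ε) (ae_of_all _ fun ω => ?_)).trans (by simp)
    rw [norm_mul, hEnorm, one_mul]
    exact hφ _
  let A (n : ℕ) : ℂ := ∫ ω, E n (fun k => τ k ω) * u (τ n ω) ∂ν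
  have hstep (n : ℕ) : A (n + 1) = (∫ ω, E n (fun k => τ k ω)
      * (∑ t, (P (τ n ω) t : ℂ) * (cexp (I * (s * f t)) * u t) - l * u (τ n ω)) ∂ν) + l * A n := by
    have e1 := h.integral_mul_comp_succ (hE n) fun t => cexp (I * (s * f t)) * u t
    have e2 : A (n + 1) = ∫ ω, E n (fun k => τ k ω)
        * (cexp (I * (s * f (τ (n + 1) ω))) * u (τ (n + 1) ω)) ∂ν := by
      refine integral_congr_ae (ae_of_all _ fun ω => ?_)
      simp only [E]
      rw [Finset.sum_Icc_succ_top (by omega), ofReal_add, mul_add, mul_add, Complex.exp_add,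
        mul_assoc]
    have i1 := hint n fun x => ∑ t, (P x t : ℂ) * (cexp (I * (s * f t)) * u t) - l * u x
    rw [e2, e1, ← integral_const_mul, ← integral_add i1 ((hint n u).const_mul l)]
    refine integral_congr_ae (ae_of_all _ fun ω => ?_)
    simp only [RCLike.ofReal_eq_complex_ofReal]
    ring
  have hA (n : ℕ) : ‖A n - l ^ n‖ ≤ ε₁ + n * ε₂ := by
    induction n with
    | zero =>
      have e0 : A 0 - l ^ 0 = ∫ ω, E 0 (fun k => τ k ω) * (u (τ 0 ω) - 1) ∂ν := by
        have : ∀ x, E 0 x = 1 := fun x => by simp [E]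
        have i0 := hint 0 u
        simp only [A, this, one_mul, pow_zero] at i0 ⊢
        rw [integral_sub i0 (integrable_const _)]
        simp
      rw [e0]
      simpa using hbd 0 (φ := fun x => u x - 1) h₁
    | succ n ih =>
      have e1 : A (n + 1) - l ^ (n + 1) = (∫ ω, E n (fun k => τ k ω)
          * (∑ t, (P (τ n ω) t : ℂ) * (cexp (I * (s * f t)) * u t) - l * u (τ n ω)) ∂ν)
          + l * (A n - l ^ n) := by
        rw [hstep]
        ring
      rw [e1]
      refine (norm_add_le _ _).trans ?_
      rw [norm_mul]
      have b1 := hbd n h₂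
      have b2 : ‖l‖ * ‖A n - l ^ n‖ ≤ ‖A n - l ^ n‖ := mul_le_of_le_one_left (norm_nonneg _) hl
      push_cast
      linarith
  have hdiff : ‖∫ ω, E n (fun k => τ k ω) ∂ν - A n‖ ≤ ε₁ := by
    have e3 : A n - ∫ ω, E n (fun k => τ k ω) ∂ν = ∫ ω, E n (fun k => τ k ω) * (u (τ n ω) - 1) ∂ν := by
      rw [← integral_sub (hint n u) (h.integrable_path (hE n))]
      exact integral_congr_ae (ae_of_all _ fun ω => by ring)
    rw [norm_sub_rev, e3]
    exact hbd n (φ := fun x => u x - 1) h₁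
  calc _ ≤ ‖∫ ω, E n (fun k => τ k ω) ∂ν - A n‖ + ‖A n - l ^ n‖ := norm_sub_le_norm_sub_add_norm_sub _ _ _
    _ ≤ _ := by linarith [hA n]

/-- The central limit theorem for a centred function, in terms of characteristic functions. -/
theorem tendsto_integral_exp (h : IsMarkovChain ν τ p₀ P) (hrow : ∀ x, ∑ t, P x t = 1)
    {f g₁ g₂ : S → ℝ} {v : ℝ} (hv : 0 ≤ v) (hg₁ : ∀ x, ∑ t, P x t * (f t + g₁ t) = g₁ x)
    (hg₂ : ∀ x, ∑ t, P x t * (f t ^ 2 / 2 + f t * g₁ t - g₂ t) = v / 2 - g₂ x) :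
    Tendsto (fun n : ℕ => ∫ ω, cexp (I * (((√(n : ℝ))⁻¹ : ℝ)
      * (∑ j ∈ Finset.Icc 1 n, f (τ j ω) : ℝ))) ∂ν) atTop (𝓝 (cexp (-(v / 2)))) := by
  obtain ⟨K₁, hK₁0, hK₁⟩ := exists_uniform_bound (approxEigenfunction_sub_one_isBigO g₁ g₂)
  obtain ⟨K₂, hK₂0, hK₂⟩ := exists_uniform_bound (approxEigenfunction_isBigO hrow hg₁ hg₂)
  have hs : Tendsto (fun n : ℕ => (√(n : ℝ))⁻¹) atTop (𝓝 0) :=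
    (Real.tendsto_sqrt_atTop.comp tendsto_natCast_atTop_atTop).inv_tendsto_atTop
  rw [tendsto_iff_norm_sub_tendsto_zero]
  have hlim : Tendsto (fun n : ℕ => (2 * K₁ + K₂) * (√(n : ℝ))⁻¹) atTop (𝓝 0) := by
    simpa using hs.const_mul (2 * K₁ + K₂)
  refine squeeze_zero' (Eventually.of_forall fun n => norm_nonneg _) ?_ hlim
  filter_upwards [hs.eventually hK₁, hs.eventually hK₂, eventually_gt_atTop 0] with n h1 h2 hn
  have hn' : (0 : ℝ) < n := by exact_mod_cast hn
  set s : ℝ := (√(n : ℝ))⁻¹ with hsdef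
  have hs0 : 0 ≤ s := by positivity
  have hns : (n : ℝ) * s ^ 2 = 1 := by
    rw [hsdef, inv_pow, Real.sq_sqrt hn'.le, mul_inv_cancel₀ hn'.ne']
  have hl : ‖cexp (-(v / 2 * s ^ 2))‖ ≤ 1 := by
    have : (-(v / 2 * s ^ 2) : ℂ) = (-(v / 2 * s ^ 2) : ℝ) := by push_cast; rfl
    rw [this, norm_exp_ofReal, Real.exp_le_one_iff]
    have : 0 ≤ v / 2 * s ^ 2 := by positivity
    linarith
  have hpow : cexp (-(v / 2 * s ^ 2)) ^ n = cexp (-(v / 2)) := by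
    rw [← Complex.exp_nat_mul]
    congr 1
    have : (n : ℂ) * s ^ 2 = 1 := by exact_mod_cast hns
    linear_combination (-(v / 2 : ℂ)) * this
  have hmain := h.norm_integral_exp_sub_pow_le hl h1 h2 n
  rw [hpow] at hmain
  -- Since `n * s ^ 2 = 1`, the bound `2 K₁ s + n K₂ s ^ 3` equals `(2 K₁ + K₂) s`.
  refine hmain.trans (le_of_eq ?_)
  rw [norm_pow, Real.norm_of_nonneg hs0]
  linear_combination K₂ * s * hns

end IsMarkovChain

/-! ### Correctors and the covariance matrix -/

section Covariance

variable {d : ℕ} {P : Matrix (CoinIndex d) (CoinIndex d) ℝ}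

/-- The asymptotic variance of the additive functional of `c`. -/
noncomputable def asymptoticVariance (P : Matrix (CoinIndex d) (CoinIndex d) ℝ)
    (c : CoinIndex d → ℝ) : ℝ :=
  -(1 / (2 * d : ℝ)) * (c ⬝ᵥ c) + (1 / (2 * d : ℝ) * ∑ x, c x) ^ 2
    - (1 / (2 * d : ℝ)) * (2 * (c ⬝ᵥ (reducedResolvent P *ᵥ c)))

/-- Solutions of the two Poisson equations of the second order perturbation expansion. -/
theorem exists_correctors (hd : d ≠ 0) (hP : P ∈ doublyStochastic ℝ (CoinIndex d))
    (hirr : P.IsIrreducible) (c : CoinIndex d → ℝ) :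
    0 ≤ asymptoticVariance P c ∧ ∃ g₁ g₂ : CoinIndex d → ℝ,
      (∀ x, ∑ t, P x t * ((projQ d *ᵥ c) t + g₁ t) = g₁ x) ∧
      ∀ x, ∑ t, P x t * ((projQ d *ᵥ c) t ^ 2 / 2 + (projQ d *ᵥ c) t * g₁ t - g₂ t)
        = asymptoticVariance P c / 2 - g₂ x := by
  have hd' : (d : ℝ) ≠ 0 := by exact_mod_cast hd
  have hdpos : (0 : ℝ) < d := by positivity
  set f := projQ d *ᵥ c with hf
  set w := reducedResolvent P *ᵥ c with hw
  set v := asymptoticVariance P c with hv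
  have hPw : P *ᵥ w = w + f := by
    have h := congrArg (fun M => M *ᵥ c) (sub_one_mul_reducedResolvent hd hP hirr)
    simp only [← mulVec_mulVec, sub_mulVec, one_mulVec] at h
    change P *ᵥ w - w = f at h
    rw [← h]
    abel
  have hQw : projQ d *ᵥ w = w := by
    rw [hw, mulVec_mulVec, projQ_mul_reducedResolvent hd hP hirr]
  have hff : f ⬝ᵥ f = c ⬝ᵥ c - 1 / (2 * d) * (∑ x, c x) ^ 2 := by
    rw [hf, dotProduct_projQ_mulVec, mulVec_mulVec, projQ_mul_self hd]
    simp only [dotProduct, projQ_mulVec, mul_sub, Finset.sum_sub_distrib, ← Finset.sum_mul]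
    ring
  have hfw : f ⬝ᵥ w = c ⬝ᵥ w := by rw [hf, dotProduct_projQ_mulVec, hQw]
  -- From `P w = w + f`: the choice makes `f + g₁ = -w`, which `P` sends to `-w - f = g₁`.
  let g₁ := -w - f
  have hfg : f + g₁ = -w := by simp only [g₁]; abel
  have hg₁ : P *ᵥ (f + g₁) = g₁ := by
    rw [hfg, mulVec_neg, hPw]
    simp only [g₁]
    abel
  have hvar : 2 * d * v = f ⬝ᵥ f + 2 * (f ⬝ᵥ g₁) := by
    have h1 : f ⬝ᵥ g₁ = -(f ⬝ᵥ w) - f ⬝ᵥ f := by simp only [g₁, dotProduct_sub, dotProduct_neg]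
    rw [h1, hfw, hff, hv, asymptoticVariance]
    field_simp
    ring
  -- Here `2 d v = |f + g₁|² - |g₁|²` with `g₁ = P (f + g₁)`, so contractivity applies.
  have hnonneg : 0 ≤ v := by
    have h1 := dotProduct_mulVec_le hP (f + g₁)
    rw [hg₁] at h1
    simp only [add_dotProduct, dotProduct_add, dotProduct_comm g₁ f] at h1
    have h2 : 0 ≤ 2 * d * v := by rw [hvar]; linarith
    exact nonneg_of_mul_nonneg_right h2 (by positivity)
  refine ⟨hnonneg, g₁, ?_⟩
  let k : CoinIndex d → ℝ := fun x => f x ^ 2 / 2 + f x * g₁ x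
  have hk : 2 * ∑ x, k x = f ⬝ᵥ f + 2 * (f ⬝ᵥ g₁) := by
    simp only [k, dotProduct, Finset.mul_sum, ← Finset.sum_add_distrib]
    exact Finset.sum_congr rfl fun x _ => by ring
  -- The solvability condition for `g₂`; it determines `v`, since `P` preserves sums.
  have hsum : ∑ x, (v / 2 - (P *ᵥ k) x) = 0 := by
    rw [Finset.sum_sub_distrib, sum_mulVec_eq hP, Finset.sum_const, Finset.card_univ,
      card_coinIndex, nsmul_eq_mul]
    push_cast
    linarith
  obtain ⟨g₂, hg₂⟩ := exists_sub_mulVec_eq hd hP hirr hsum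
  refine ⟨g₂, fun x => congrFun hg₁ x, fun x => ?_⟩
  have h1 := congrFun hg₂ x
  have h2 : ∑ t, P x t * (f t ^ 2 / 2 + f t * g₁ t - g₂ t) = (P *ᵥ k) x - (P *ᵥ g₂) x := by
    simp only [mulVec, dotProduct, ← Finset.sum_sub_distrib, k]
    exact Finset.sum_congr rfl fun x _ => by ring
  rw [h2]
  simp only [Pi.sub_apply] at h1
  linarith

variable (r : CoinIndex d → Fin d → ℤ)

theorem drift_apply (i : Fin d) : drift r i = 1 / (2 * d : ℝ) * ∑ x, jumpComp r i x := by
  simp [drift, jumpVec, jumpComp]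

theorem projQ_mulVec_jumpComp (i : Fin d) (x : CoinIndex d) :
    (projQ d *ᵥ jumpComp r i) x = jumpVec r x i - drift r i := by
  rw [projQ_mulVec, drift_apply]
  rfl

theorem inner_jumpVec_sub_drift (t : EuclideanSpace ℝ (Fin d)) (x : CoinIndex d) :
    inner ℝ (jumpVec r x - drift r) t = (projQ d *ᵥ ∑ i, t i • jumpComp r i) x := by
  rw [PiLp.inner_apply, mulVec_sum, Finset.sum_apply]
  refine Finset.sum_congr rfl fun i _ => ?_
  rw [mulVec_smul, Pi.smul_apply, projQ_mulVec_jumpComp]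
  rfl

/-- Bilinearity in the components of `r`; the two resolvent terms coincide after swapping `i` and
`j`. This links the matrix to the scalar theory. -/
theorem dotProduct_covMatrix_mulVec (t : Fin d → ℝ) :
    t ⬝ᵥ (covMatrix r P *ᵥ t) = asymptoticVariance P (∑ i, t i • jumpComp r i) := by
  have h1 (M : Matrix (CoinIndex d) (CoinIndex d) ℝ) :
      (∑ i, t i • jumpComp r i) ⬝ᵥ (M *ᵥ ∑ i, t i • jumpComp r i)
        = ∑ i, ∑ j, t i * t j * (jumpComp r i ⬝ᵥ (M *ᵥ jumpComp r j)) := by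
    simp only [mulVec_sum, sum_dotProduct, dotProduct_sum, mulVec_smul, smul_dotProduct,
      dotProduct_smul, smul_eq_mul, Finset.mul_sum]
    rw [Finset.sum_comm]
    exact Finset.sum_congr rfl fun i _ => Finset.sum_congr rfl fun j _ => by ring
  have h2 := h1 1
  simp only [one_mulVec] at h2
  have h3 : ∑ x, (∑ i, t i • jumpComp r i) x = ∑ i, t i * ∑ x, jumpComp r i x := by
    simp only [Finset.sum_apply, Pi.smul_apply, smul_eq_mul, Finset.mul_sum]
    exact Finset.sum_comm
  have h4 : ∑ i, ∑ j, t i * t j * (jumpComp r i ⬝ᵥ (reducedResolvent P *ᵥ jumpComp r j))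
      = ∑ i, ∑ j, t i * t j * (jumpComp r j ⬝ᵥ (reducedResolvent P *ᵥ jumpComp r i)) := by
    rw [Finset.sum_comm]
    exact Finset.sum_congr rfl fun i _ => Finset.sum_congr rfl fun j _ => by ring
  have h5 : (1 / (2 * d : ℝ) * ∑ i, t i * ∑ x, jumpComp r i x) ^ 2
      = ∑ i, ∑ j, t i * t j * (drift r i * drift r j) := by
    rw [sq, Finset.mul_sum, Finset.sum_mul_sum]
    refine Finset.sum_congr rfl fun i _ => Finset.sum_congr rfl fun j _ => ?_
    rw [drift_apply, drift_apply]
    ring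
  have h6 : t ⬝ᵥ (covMatrix r P *ᵥ t) = ∑ i, ∑ j, t i * t j * covMatrix r P i j := by
    simp only [dotProduct, mulVec, Finset.mul_sum]
    exact Finset.sum_congr rfl fun i _ => Finset.sum_congr rfl fun j _ => by ring
  have h7 := two_mul (∑ i, ∑ j, t i * t j * (jumpComp r i ⬝ᵥ (reducedResolvent P *ᵥ jumpComp r j)))
  nth_rewrite 3 [h4] at h7
  rw [asymptoticVariance, h1, h2, h3, h5, h6, h7]
  simp only [Finset.mul_sum, ← Finset.sum_add_distrib, ← Finset.sum_sub_distrib]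
  refine Finset.sum_congr rfl fun i _ => Finset.sum_congr rfl fun j _ => ?_
  simp only [covMatrix, of_apply]
  ring

theorem posSemidef_covMatrix (hd : d ≠ 0) (hP : P ∈ doublyStochastic ℝ (CoinIndex d))
    (hirr : P.IsIrreducible) : (covMatrix r P).PosSemidef := by
  refine PosSemidef.of_dotProduct_mulVec_nonneg ?_ fun t => ?_
  · ext i j
    simp only [conjTranspose_apply, covMatrix, of_apply, star_trivial]
    rw [dotProduct_comm (jumpComp r j) (jumpComp r i)]
    ring
  · rw [star_trivial, dotProduct_covMatrix_mulVec]
    exact (exists_correctors hd hP hirr _).1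

end Covariance

/-! ### Limit theorems for the position -/

namespace IsMarkovChain

variable {d : ℕ} {X : Type*} [MeasurableSpace X] {ν : Measure X} [IsProbabilityMeasure ν]
  {τ : ℕ → X → CoinIndex d} {p₀ : CoinIndex d → ℝ} {P : Matrix (CoinIndex d) (CoinIndex d) ℝ}

/-- The law of large numbers for the position process. -/
theorem ae_tendsto_average (h : IsMarkovChain ν τ p₀ P) (hd : d ≠ 0)
    (hP : P ∈ doublyStochastic ℝ (CoinIndex d)) (hirr : P.IsIrreducible)
    (r : CoinIndex d → Fin d → ℤ) :
    ∀ᵐ ω ∂ν, Tendsto (fun n : ℕ => (1 / (n : ℝ)) • ∑ j ∈ Finset.Icc 1 n, jumpVec r (τ j ω))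
      atTop (𝓝 (drift r)) := by
  have hcomp (i : Fin d) : ∀ᵐ ω ∂ν, Tendsto (fun n : ℕ =>
      (∑ j ∈ Finset.Icc 1 n, (projQ d *ᵥ jumpComp r i) (τ j ω)) / n) atTop (𝓝 0) := by
    obtain ⟨-, g₁, -, hg₁, -⟩ := exists_correctors hd hP hirr (jumpComp r i)
    exact h.ae_tendsto_sum_div hg₁
  filter_upwards [ae_all_iff.2 hcomp] with ω hω
  have hpi : Tendsto (fun n : ℕ => WithLp.ofLp
      ((1 / (n : ℝ)) • ∑ j ∈ Finset.Icc 1 n, jumpVec r (τ j ω))) atTop (𝓝 (WithLp.ofLp (drift r))) := by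
    refine tendsto_pi_nhds.2 fun i => ?_
    have h1 := (hω i).add_const (drift r i)
    rw [zero_add] at h1
    refine h1.congr' ?_
    filter_upwards [eventually_gt_atTop 0] with n hn
    have hn' : (n : ℝ) ≠ 0 := by positivity
    simp only [projQ_mulVec_jumpComp, Finset.sum_sub_distrib, Finset.sum_const, Nat.card_Icc,
      nsmul_eq_mul, WithLp.ofLp_smul, WithLp.ofLp_sum, Pi.smul_apply, Finset.sum_apply, smul_eq_mul,
      Nat.add_sub_cancel]
    field_simp
    ring
  exact ((PiLp.continuous_toLp 2 _).tendsto _).comp hpi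

/-- The central limit theorem for the position process. -/
theorem tendstoInDistribution_sum (h : IsMarkovChain ν τ p₀ P) (hd : d ≠ 0)
    (hP : P ∈ doublyStochastic ℝ (CoinIndex d)) (hirr : P.IsIrreducible)
    (r : CoinIndex d → Fin d → ℤ) :
    TendstoInDistribution
      (fun (n : ℕ) (ω : X) => (1 / √(n : ℝ)) • ∑ j ∈ Finset.Icc 1 n, (jumpVec r (τ j ω) - drift r))
      atTop (id : EuclideanSpace ℝ (Fin d) → EuclideanSpace ℝ (Fin d)) (fun _ => ν)
      (multivariateGaussian 0 (covMatrix r P)) := by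
  have hmeas (n : ℕ) : Measurable fun ω =>
      (1 / √(n : ℝ)) • ∑ j ∈ Finset.Icc 1 n, (jumpVec r (τ j ω) - drift r) :=
    Measurable.const_smul (g := fun ω => ∑ j ∈ Finset.Icc 1 n, (jumpVec r (τ j ω) - drift r))
      (Finset.measurable_sum _ fun j _ =>
        (measurable_of_finite fun x => jumpVec r x - drift r).comp (h.measurable j)) (1 / √(n : ℝ))
  refine ⟨fun n => (hmeas n).aemeasurable, aemeasurable_id, ?_⟩
  refine ProbabilityMeasure.tendsto_iff_tendsto_charFun.2 fun t => ?_
  simp only [ProbabilityMeasure.coe_mk, Measure.map_id]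
  rw [charFun_multivariateGaussian (posSemidef_covMatrix r hd hP hirr),
    dotProduct_covMatrix_mulVec]
  -- The characteristic function at `t` only sees the scalar functional of `c`, centred by `Q`.
  set c := ∑ i, t i • jumpComp r i with hc
  obtain ⟨hv, g₁, g₂, hg₁, hg₂⟩ := exists_correctors hd hP hirr c
  have hlim := h.tendsto_integral_exp (fun x => sum_row_of_mem_doublyStochastic hP x) hv hg₁ hg₂
  have hinner (x : CoinIndex d) : inner ℝ (jumpVec r x - drift r) t = (projQ d *ᵥ c) x :=
    inner_jumpVec_sub_drift r t x
  simp only [inner_zero_right, Complex.ofReal_zero, zero_mul, zero_sub]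
  refine hlim.congr fun n => ?_
  rw [charFun_apply, integral_map (hmeas n).aemeasurable (by fun_prop)]
  refine integral_congr_ae (ae_of_all _ fun ω => ?_)
  simp only [real_inner_smul_left, sum_inner, hinner]
  rw [mul_comm Complex.I, one_div]
  push_cast
  rfl

end IsMarkovChain

/-! ### Reading the permutation off the coin matrix -/

section RandomPermutation

variable {d : ℕ}

/-- The map `τ ↦ σ` read off from the nonzero entries `M σ τ` of a phased permutation matrix. -/
noncomputable def supportMap [Nonempty (CoinIndex d)] (M : Matrix (CoinIndex d) (CoinIndex d) ℂ)
    (τ : CoinIndex d) : CoinIndex d :=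
  Classical.epsilon fun σ => M σ τ ≠ 0

/-- The value depends on `M` only through the finite pattern of nonzero entries. This yields
measurability, independence and equal laws of the permutation parts from those of the matrices. -/
theorem measurable_supportMap [Nonempty (CoinIndex d)] : Measurable (supportMap (d := d)) := by
  refine measurable_pi_lambda _ fun τ => ?_
  have h1 : Measurable fun (M : Matrix (CoinIndex d) (CoinIndex d) ℂ) σ => M σ τ ≠ 0 := by
    refine measurable_pi_lambda _ fun σ => measurableSet_setOfPred.1 ?_
    have h2 : Measurable fun M : Matrix (CoinIndex d) (CoinIndex d) ℂ => M σ τ :=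
      (measurable_pi_apply τ).comp (measurable_pi_apply σ)
    exact h2 (measurableSet_singleton 0).compl
  exact (measurable_of_finite (Classical.epsilon : (CoinIndex d → Prop) → CoinIndex d)).comp h1

theorem supportMap_phasedPerm [Nonempty (CoinIndex d)] (p : Equiv.Perm (CoinIndex d))
    (Θ : CoinIndex d → ℝ) : supportMap (phasedPerm p Θ) = p := by
  ext1 τ
  have : (fun σ => phasedPerm p Θ σ τ ≠ 0) = fun σ => σ = p τ := by
    ext σ
    simp [phasedPerm, Complex.exp_ne_zero]
  rw [supportMap, this, Classical.epsilon_singleton]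

variable {X : Type*} [MeasurableSpace X] {ν : Measure X} [IsProbabilityMeasure ν]

theorem sum_measureReal_eq_one {T : Type*} [Fintype T] [MeasurableSpace T]
    [MeasurableSingletonClass T] {Y : X → T} (hY : Measurable Y) :
    ∑ y, ν.real {ω | Y ω = y} = 1 := by
  simpa using (integral_comp_eq_sum (ν := ν) hY fun _ => (1 : ℝ)).symm

theorem transitionMatrix_apply [Nonempty (CoinIndex d)]
    {C : X → Matrix (CoinIndex d) (CoinIndex d) ℂ} (hC : Measurable C)
    {π : X → Equiv.Perm (CoinIndex d)} (hπ : ∀ ω, ∃ Θ, C ω = phasedPerm (π ω) Θ)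
    (x y : CoinIndex d) : transitionMatrix ν C x y = ν.real {ω | π ω x = y} := by
  have hsupp (ω : X) : supportMap (C ω) = π ω := by
    obtain ⟨Θ, h⟩ := hπ ω
    rw [h, supportMap_phasedPerm]
  -- Permutations carry no σ-algebra in the statement; the discrete one serves locally.
  let _ : MeasurableSpace (Equiv.Perm (CoinIndex d)) := ⊤
  have : MeasurableSingletonClass (Equiv.Perm (CoinIndex d)) := ⟨fun _ => trivial⟩
  have hmeas : Measurable π := measurable_to_countable' fun p => by
    have : π ⁻¹' {p} = (supportMap ∘ C) ⁻¹' {⇑p} := by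
      ext ω
      simp [hsupp]
    rw [this]
    exact (measurable_supportMap.comp hC) (measurableSet_singleton _)
  have hlaw (p : Equiv.Perm (CoinIndex d)) : permLaw ν C p = ν.real {ω | π ω = p} := by
    rw [permLaw]
    congr 1
    ext ω
    constructor
    · rintro ⟨Θ, h⟩
      have h1 := hsupp ω
      rw [h, supportMap_phasedPerm] at h1
      exact DFunLike.coe_injective h1.symm
    · rintro rfl
      exact hπ ω
  have hsx : MeasurableSet {ω | π ω x = y} := hmeas (t := {p | p x = y}) trivial
  have h1 := integral_comp_eq_sum (ν := ν) hmeas fun p => if y = p x then (1 : ℝ) else 0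
  have h2 : ∫ ω, (if y = π ω x then (1 : ℝ) else 0) ∂ν = ν.real {ω | π ω x = y} := by
    rw [← integral_indicator_one hsx]
    refine integral_congr_ae (ae_of_all _ fun ω => ?_)
    simp [Set.indicator_apply, eq_comm]
  rw [← h2, h1]
  simp only [transitionMatrix, of_apply, hlaw, smul_eq_mul]

end RandomPermutation

end QuantumWalk

/-! ### Assembly -/

theorem mainTheorem6 {d : ℕ} (r : QuantumWalk.CoinIndex d → Fin d → ℤ)
    {X : Type*} [MeasurableSpace X] (ν : Measure X) [IsProbabilityMeasure ν]
    -- the i.i.d. random phased permutation matrices `C_1 = C 0, C_2 = C 1, …`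
    (C : ℕ → X → Matrix (QuantumWalk.CoinIndex d) (QuantumWalk.CoinIndex d) ℂ)
    (hCmeas : ∀ k, Measurable (C k))
    (hCindep : iIndepFun C ν)
    (hCident : ∀ k, IdentDistrib (C k) (C 0) ν ν)
    -- their permutation parts
    (π : ℕ → X → Equiv.Perm (QuantumWalk.CoinIndex d))
    (hπ : ∀ k ω, ∃ Θ : QuantumWalk.CoinIndex d → ℝ, C k ω = QuantumWalk.phasedPerm (π k ω) Θ)
    -- the initial coin state and the initial point of the path
    (φ₀ : EuclideanSpace ℂ (QuantumWalk.CoinIndex d)) (hφ₀ : ‖φ₀‖ = 1)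
    (τ₀ : X → QuantumWalk.CoinIndex d) (hτ₀meas : Measurable τ₀)
    (hτ₀law : ∀ σ, ν.real {ω | τ₀ ω = σ} = ‖φ₀ σ‖ ^ 2)
    (hτ₀indep : IndepFun τ₀ (fun ω k => C k ω) ν)
    (hirr : (QuantumWalk.transitionMatrix ν (C 0)).IsIrreducible) :
    -- `P` is doubly stochastic and is the expectation of the transposed permutation matrices
    QuantumWalk.transitionMatrix ν (C 0) ∈ doublyStochastic ℝ (QuantumWalk.CoinIndex d) ∧
    (∀ k σ' σ, ((QuantumWalk.transitionMatrix ν (C 0) σ' σ : ℝ) : ℂ)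
      = ∫ ω, (QuantumWalk.phasedPerm (π k ω) 0)ᵀ σ' σ ∂ν) ∧
    -- the coin path is a Markov chain with finite state space
    QuantumWalk.IsMarkovChain ν (QuantumWalk.coinPath τ₀ π) (fun σ => ‖φ₀ σ‖ ^ 2)
      (QuantumWalk.transitionMatrix ν (C 0)) ∧
    -- law of large numbers
    (∀ᵐ ω ∂ν, Tendsto
      (fun n : ℕ => (1 / (n : ℝ)) •
        ∑ j ∈ Finset.Icc 1 n, QuantumWalk.jumpVec r (QuantumWalk.coinPath τ₀ π j ω))
      atTop (𝓝 (QuantumWalk.drift r))) ∧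
    -- the reduced resolvent is well defined
    IsUnit (QuantumWalk.projQ d * QuantumWalk.transitionMatrix ν (C 0) * QuantumWalk.projQ d - 1) ∧
    (QuantumWalk.transitionMatrix ν (C 0) - 1)
        * QuantumWalk.reducedResolvent (QuantumWalk.transitionMatrix ν (C 0))
      = QuantumWalk.projQ d ∧
    QuantumWalk.reducedResolvent (QuantumWalk.transitionMatrix ν (C 0))
        * (QuantumWalk.transitionMatrix ν (C 0) - 1)
      = QuantumWalk.projQ d ∧
    -- the covariance matrix, and the central limit theorem
    (QuantumWalk.covMatrix r (QuantumWalk.transitionMatrix ν (C 0))).PosSemidef ∧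
    TendstoInDistribution
      (fun (n : ℕ) (ω : X) => (1 / √(n : ℝ)) •
        ∑ j ∈ Finset.Icc 1 n,
          (QuantumWalk.jumpVec r (QuantumWalk.coinPath τ₀ π j ω) - QuantumWalk.drift r))
      atTop (id : EuclideanSpace ℝ (Fin d) → EuclideanSpace ℝ (Fin d)) (fun _ => ν)
      (multivariateGaussian 0 (QuantumWalk.covMatrix r (QuantumWalk.transitionMatrix ν (C 0)))) := by
  have : Nonempty X := nonempty_of_isProbabilityMeasure ν
  have hne : Nonempty (QuantumWalk.CoinIndex d) := this.map τ₀
  -- A probability space is nonempty, so `τ₀` takes a value and a coin state exists.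
  have hd : d ≠ 0 := by
    rintro rfl
    have h := Fintype.card_pos_iff.2 hne
    rw [QuantumWalk.card_coinIndex] at h
    simp at h
  have hsupp (k : ℕ) (ω : X) : QuantumWalk.supportMap (C k ω) = π k ω := by
    obtain ⟨Θ, h⟩ := hπ k ω
    rw [h, QuantumWalk.supportMap_phasedPerm]
  have hG (k : ℕ) : Measurable fun ω => ⇑(π k ω) := by
    have := QuantumWalk.measurable_supportMap.comp (hCmeas k)
    rwa [show QuantumWalk.supportMap ∘ C k = fun ω => ⇑(π k ω) from funext (hsupp k)] at this
  have hGx (k : ℕ) (x : QuantumWalk.CoinIndex d) : Measurable fun ω => π k ω x :=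
    (measurable_pi_apply x).comp (hG k)
  have hGindep : iIndepFun (fun k ω => ⇑(π k ω)) ν := by
    have := hCindep.comp (fun _ => QuantumWalk.supportMap)
      fun _ => QuantumWalk.measurable_supportMap
    rwa [show (fun k => QuantumWalk.supportMap ∘ C k) = fun k ω => ⇑(π k ω) from
      funext fun k => funext (hsupp k)] at this
  have hindep : IndepFun τ₀ (fun ω k => ⇑(π k ω)) ν := by
    have := hτ₀indep.comp measurable_id (measurable_pi_lambda
      (fun (M : ℕ → Matrix (QuantumWalk.CoinIndex d) (QuantumWalk.CoinIndex d) ℂ) k =>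
        QuantumWalk.supportMap (M k))
      fun k => QuantumWalk.measurable_supportMap.comp (measurable_pi_apply k))
    rwa [Function.id_comp, show (fun (M : ℕ → Matrix (QuantumWalk.CoinIndex d)
      (QuantumWalk.CoinIndex d) ℂ) k => QuantumWalk.supportMap (M k)) ∘ (fun ω k => C k ω)
      = fun ω k => ⇑(π k ω) from funext fun ω => funext fun k => hsupp k ω] at this
  set P := QuantumWalk.transitionMatrix ν (C 0) with hPdef
  have hP (k : ℕ) (x y : QuantumWalk.CoinIndex d) : ν.real {ω | π k ω x = y} = P x y := by
    rw [hPdef, QuantumWalk.transitionMatrix_apply (hCmeas 0) (hπ 0)]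
    have hs : MeasurableSet {M : Matrix (QuantumWalk.CoinIndex d) (QuantumWalk.CoinIndex d) ℂ |
        QuantumWalk.supportMap M x = y} :=
      ((measurable_pi_apply x).comp QuantumWalk.measurable_supportMap) (measurableSet_singleton y)
    have h := (hCident k).measure_mem_eq hs
    simp only [Set.preimage_ofPred_eq, hsupp] at h
    rw [measureReal_def, measureReal_def, h]
  have hds : P ∈ doublyStochastic ℝ (QuantumWalk.CoinIndex d) := by
    refine mem_doublyStochastic_iff_sum.2 ⟨fun x y => ?_, fun x => ?_, fun y => ?_⟩
    · rw [← hP 0]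
      exact measureReal_nonneg
    · simp only [← hP 0]
      exact QuantumWalk.sum_measureReal_eq_one (hGx 0 x)
    -- The column sum over `x` is the total mass of the law of the preimage of `y` under `π 0`.
    · have hinv : Measurable fun ω => (π 0 ω).symm y := measurable_to_countable' fun x => by
        have : (fun ω => (π 0 ω).symm y) ⁻¹' {x} = (fun ω => π 0 ω x) ⁻¹' {y} := by
          ext ω
          exact (π 0 ω).symm_apply_eq.trans eq_comm
        rw [this]
        exact hGx 0 x (measurableSet_singleton y)
      have h := QuantumWalk.sum_measureReal_eq_one (ν := ν) hinv
      simp only [Equiv.symm_apply_eq] at h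
      simp only [← hP 0, eq_comm (b := y)]
      exact h
  have hMC : QuantumWalk.IsMarkovChain ν (QuantumWalk.coinPath τ₀ π) (fun σ => ‖φ₀ σ‖ ^ 2) P := by
    have h := QuantumWalk.isMarkovChain_of_randomMap (τ := QuantumWalk.coinPath τ₀ π) hG hGindep
      hτ₀meas (fun _ _ => rfl) hindep hP
    rwa [show (fun s => ν.real {ω | QuantumWalk.coinPath τ₀ π 0 ω = s}) = fun σ => ‖φ₀ σ‖ ^ 2 from
      funext hτ₀law] at h
  refine ⟨hds, fun k σ' σ => ?_, hMC, hMC.ae_tendsto_average hd hds hirr r,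
    QuantumWalk.isUnit_projQ_mul_mul_projQ_sub_one hd hds hirr,
    QuantumWalk.sub_one_mul_reducedResolvent hd hds hirr,
    QuantumWalk.reducedResolvent_mul_sub_one hd hds hirr,
    QuantumWalk.posSemidef_covMatrix r hd hds hirr,
    hMC.tendstoInDistribution_sum hd hds hirr r⟩
  have h := QuantumWalk.integral_comp_eq_sum (ν := ν) (hGx k σ')
    fun y => if σ = y then (1 : ℂ) else 0
  simp only [hP k, smul_ite, smul_zero, Finset.sum_ite_eq, Finset.mem_univ, if_true,
    Complex.real_smul, mul_one] at h
  rw [← h]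
  refine integral_congr_ae (ae_of_all _ fun ω => ?_)
  simp [QuantumWalk.phasedPerm, transpose_apply]
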